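/- All topological spaces are Hausdorff. A \emph{manifold} is a Hausdorff topological space $M$ such that each $p\in M$ has an open neighbourhood $U$ admitting a \emph{chart}, i.e. a homeomorphism $\phi\colon U\to V$ onto an open subset $V$ of a (real, Hausdorff, not necessarily locally convex) topological vector space $E$, which may depend on $p$. Let $M$ be a manifold and let $(M_\alpha)_{\alpha\in A}$ be a family of subsets of $M$ indexed by a directed set $(A,\le)$, with $M_\alpha\subseteq M_\beta$ for $\alpha\le\beta$ and $M=\bigcup_{\alpha\in A}M_\alpha$. Let each $M_\alpha$ be endowed with a topology of its own (not necessarily the subspace topology) making it a manifold, such that all inclusion maps $M_\alpha\to M$ and $M_\alpha\to M_\beta$ (for $\alpha\le\beta$) are continuous. A \emph{weak direct limit chart} of $M=\bigcup_\alpha M_\alpha$ is a chart $\phi\colon U\to V\subseteq E$ of $M$ for which there exist $\alpha_0\in A$, charts $\phi_\alpha\colon U_\alpha\to V_\alpha$ of $M_\alpha$ from open subsets $U_\alpha\subseteq M_\alpha$ onto open subsets $V_\alpha$ of topological vector spaces $E_\alpha$ (for $\alpha\ge\alpha_0$), and continuous linear maps $\lambda_\alpha\colon E_\alpha\to E$ (for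 $\alpha\ge\alpha_0$) and $\lambda_{\beta,\alpha}\colon E_\alpha\to E_\beta$ (for $\beta\ge\alpha\ge\alpha_0$) such that (a) $U_\alpha\subseteq U$ and $\phi|_{U_\alpha}=\lambda_\alpha\circ\phi_\alpha$ for all $\alpha\ge\alpha_0$; (b) $U_\alpha\subseteq U_\beta$ and $\phi_\beta|_{U_\alpha}=\lambda_{\beta,\alpha}\circ\phi_\alpha$ for all $\beta\ge\alpha\ge\alpha_0$; (c) $U=\bigcup_{\alpha\ge\alpha_0}U_\alpha$. Assume that $M$ \emph{admits weak direct limit charts}, i.e. each point of $M$ lies in the domain of a weak direct limit chart. \textbf{Theorem.} For all $k\in\mathbb N_0$ and $p\in M$, \[ \pi_k(M,p)\;=\;\varinjlim_{\alpha\in A_p}\pi_k(M_\alpha,p),\qquad A_p:=\{\alpha\in A : p\in M_\alpha\}, \] that is, the canonical map $\varinjlim_{\alpha\in A_p}\pi_k(M_\alpha,p)\to\pi_k(M,p)$ induced by the inclusion maps $M_\alpha\to M$ is a bijection. If $k\ge1$, it is an isomorphism of groups from the direct limit in the category of groups. If $M$ and all $M_\alpha$ are topological groups and the inclusion maps $M_\alpha\to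 M$ are homomorphisms, then for $p=1$ and $k=0$ it is an isomorphism of groups as well, where $\pi_0(G,1)=G/G_{(1)}$ is the group of path components of a topological group $G$ (with $G_{(1)}$ the path component of $1$). -/

import Mathlib

open Set Topology
open scoped Topology.Homotopy

universe u v w

/-! ### Topological vector spaces and topological manifolds modelled on them -/

/-- A real Hausdorff topological vector space (not necessarily locally convex). -/
structure HausdorffTVS : Type (w + 1) where
  carrier : Type w
  [addCommGroup : AddCommGroup carrier]
  [module : Module ℝ carrier]
  [topologicalSpace : TopologicalSpace carrier]
  [isTopologicalAddGroup : IsTopologicalAddGroup carrier]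
  [continuousSMul : ContinuousSMul ℝ carrier]
  [t2Space : T2Space carrier]

namespace HausdorffTVS

instance : CoeSort HausdorffTVS.{w} (Type w) := ⟨HausdorffTVS.carrier⟩

attribute [instance] addCommGroup module topologicalSpace isTopologicalAddGroup
  continuousSMul t2Space

end HausdorffTVS

/-- A (topological) manifold modelled on topological vector spaces: a Hausdorff space in which
every point lies in the domain of a homeomorphism from an open subset onto an open subset of some
Hausdorff topological vector space. The modelling space may depend on the point. -/
def IsTVSManifold (M : Type u) [TopologicalSpace M] : Prop :=
  T2Space M ∧ ∀ p : M, ∃ (E : HausdorffTVS.{w}) (φ : OpenPartialHomeomorph M E), p ∈ φ.source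

/-! ### Directed unions -/

/-- A presentation `M = ⋃ α, M_α` of a topological space as the union of an increasing family of
subsets `M_α`, each endowed with a topology of its own (in general *not* the subspace topology),
such that all inclusion maps `M_α → M` and `M_α → M_β` for `α ≤ β` are continuous. -/
structure DirectedUnion (A : Type v) [Preorder A] (M : Type u) [TopologicalSpace M] where
  carrier : A → Set M
  topology : ∀ α, TopologicalSpace (carrier α)
  mono : ∀ ⦃α β : A⦄, α ≤ β → carrier α ⊆ carrier β
  iUnion_eq : ⋃ α, carrier α = univ
  continuous_incl : ∀ α, Continuous[topology α, inferInstance] (Subtype.val : carrier α → M)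
  continuous_inclusion : ∀ ⦃α β : A⦄ (h : α ≤ β),
    Continuous[topology α, topology β] (Set.inclusion (mono h))

namespace DirectedUnion

variable {A : Type v} [Preorder A] {M : Type u} [TopologicalSpace M] (D : DirectedUnion A M)

/-- The step `M_α`, as a type. It is a type synonym, so that the only topology on it is the given
one, and not the subspace topology. -/
def Step (α : A) : Type u := D.carrier α

instance (α : A) : TopologicalSpace (D.Step α) := D.topology α

/-- The continuous inclusion map `M_α → M`. -/
def incl (α : A) : C(D.Step α, M) where
  toFun x := x.1
  continuous_toFun := D.continuous_incl α

/-- The continuous inclusion map `M_α → M_β`, for `α ≤ β`. -/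
def inclusion {α β : A} (h : α ≤ β) : C(D.Step α, D.Step β) where
  toFun := Set.inclusion (D.mono h)
  continuous_toFun := D.continuous_inclusion h

theorem incl_injective (α : A) : Function.Injective (D.incl α) := Subtype.val_injective

@[simp] theorem incl_inclusion {α β : A} (h : α ≤ β) (x : D.Step α) :
    D.incl β (D.inclusion h x) = D.incl α x := rfl

end DirectedUnion

/-! ### Weak direct limit charts -/

/-- The chart `φ : U → V ⊆ E` of `M = ⋃ α, M_α` is a *weak direct limit chart*: there are an
index `α₀`, charts `φ_α : U_α → V_α ⊆ E_α` of `M_α` for `α ≥ α₀`, and continuous linear maps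
`λ_α : E_α → E` (for `α ≥ α₀`) and `λ_{β,α} : E_α → E_β` (for `β ≥ α ≥ α₀`), such that
(a) `U_α ⊆ U` and `φ = λ_α ∘ φ_α` on `U_α`;
(b) `U_α ⊆ U_β` and `φ_β = λ_{β,α} ∘ φ_α` on `U_α` if `β ≥ α`;
(c) `U` is the union of the `U_α`. -/
def IsWeakDirectLimitChart {A : Type v} [Preorder A] {M : Type u} [TopologicalSpace M]
    (D : DirectedUnion A M) {E : HausdorffTVS.{w}} (φ : OpenPartialHomeomorph M E) : Prop :=
  ∃ (α₀ : A) (F : Set.Ici α₀ → HausdorffTVS.{w})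
    (ψ : ∀ α : Set.Ici α₀, OpenPartialHomeomorph (D.Step α) (F α))
    (l : ∀ α : Set.Ici α₀, F α →L[ℝ] E)
    (m : ∀ α β : Set.Ici α₀, α ≤ β → (F α →L[ℝ] F β)),
    (∀ (α : Set.Ici α₀), ∀ x ∈ (ψ α).source,
      D.incl α x ∈ φ.source ∧ φ (D.incl α x) = l α (ψ α x)) ∧
    (∀ (α β : Set.Ici α₀) (h : α ≤ β), ∀ x ∈ (ψ α).source,
      D.inclusion h x ∈ (ψ β).source ∧ ψ β (D.inclusion h x) = m α β h (ψ α x)) ∧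
    φ.source = ⋃ α : Set.Ici α₀, D.incl α '' (ψ α).source

/-- `M = ⋃ α, M_α` admits weak direct limit charts: each point of `M` lies in the domain of
one. -/
def AdmitsWeakDirectLimitCharts {A : Type v} [Preorder A] {M : Type u} [TopologicalSpace M]
    (D : DirectedUnion A M) : Prop :=
  ∀ q : M, ∃ (E : HausdorffTVS.{w}) (φ : OpenPartialHomeomorph M E),
    q ∈ φ.source ∧ IsWeakDirectLimitChart.{u, v, w} D φ

/-! ### Functoriality of homotopy groups -/

namespace HomotopyGroup

variable {N : Type*} {X Y Z : Type*} [TopologicalSpace X] [TopologicalSpace Y]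
  [TopologicalSpace Z]

/-- Composition of a generalized loop with a continuous map. -/
def mapLoop (f : C(X, Y)) {x : X} {y : Y} (h : f x = y) (γ : Ω^ N X x) : Ω^ N Y y :=
  ⟨f.comp γ.1, fun t ht => by
    rw [ContinuousMap.comp_apply, γ.2 t ht, h]⟩

/-- The map `f_* : π_N(X, x) → π_N(Y, y)`, `[γ] ↦ [f ∘ γ]` induced by a continuous map `f` with
`f x = y`. -/
def map (f : C(X, Y)) {x : X} {y : Y} (h : f x = y) : HomotopyGroup N X x → HomotopyGroup N Y y :=
  Quotient.map (mapLoop f h) fun _ _ H =>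
    ContinuousMap.HomotopicRel.comp_continuousMap H f

theorem map_mk (f : C(X, Y)) {x : X} {y : Y} (h : f x = y) (γ : Ω^ N X x) :
    map f h (Quotient.mk _ γ : HomotopyGroup N X x) = Quotient.mk _ (mapLoop f h γ) := rfl

theorem map_id {x : X} (h : ContinuousMap.id X x = x) (a : HomotopyGroup N X x) :
    map (ContinuousMap.id X) h a = a := by
  induction a using Quotient.inductionOn with
  | h γ => rfl

theorem map_map (f : C(X, Y)) (g : C(Y, Z)) {x : X} {y : Y} {z : Z} (hf : f x = y) (hg : g y = z)
    (hgf : (g.comp f) x = z) (a : HomotopyGroup N X x) :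
    map g hg (map f hf a) = map (g.comp f) hgf a := by
  induction a using Quotient.inductionOn with
  | h γ => rfl

theorem map_mul [DecidableEq N] [Nonempty N] (f : C(X, Y)) {x : X} {y : Y} (h : f x = y)
    (a b : HomotopyGroup N X x) : map f h (a * b) = map f h a * map f h b := by
  induction a using Quotient.inductionOn with
  | h γ =>
    induction b using Quotient.inductionOn with
    | h δ =>
      have i : N := Classical.arbitrary N
      refine (congrArg (map f h) (mul_spec (i := i) (p := γ) (q := δ))).trans ?_
      refine Eq.trans ?_ (mul_spec (i := i) (p := mapLoop f h γ) (q := mapLoop f h δ)).symm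
      rw [map_mk]
      congr 1
      ext t
      change f (GenLoop.transAt i δ γ t) = GenLoop.transAt i (mapLoop f h δ) (mapLoop f h γ) t
      simp only [GenLoop.transAt, GenLoop.coe_copy]
      split_ifs <;> rfl

/-- The induced map as a homomorphism of groups. -/
noncomputable def mapHom [DecidableEq N] [Nonempty N] (f : C(X, Y)) {x : X} {y : Y} (h : f x = y) :
    HomotopyGroup N X x →* HomotopyGroup N Y y :=
  MonoidHom.mk' (map f h) (map_mul f h)

end HomotopyGroup

/-! ### The group `π_0` of a topological group -/

section PiZero

variable {G : Type*} [Group G] [TopologicalSpace G] [IsTopologicalGroup G]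

/-- The path components of a topological group form a group, namely the quotient of `G` by the
path component of `1`; the product is induced by the product of `G`. -/
instance zerothHomotopyGroup : Group (ZerothHomotopy G) :=
  inferInstanceAs (Group (Con.Quotient
    { toSetoid := pathSetoid G
      mul' := fun h₁ h₂ => Joined.mul h₁ h₂ : Con G }))

theorem ZerothHomotopy.mk_mul_mk (x y : G) :
    ZerothHomotopy.mk x * ZerothHomotopy.mk y = ZerothHomotopy.mk (x * y) := rfl

/-- The group structure on `π_0(G, e)`, transported from the group of path components. -/
instance piZeroGroup (e : G) : Group (π_ 0 G e) :=
  (HomotopyGroup.pi0EquivZerothHomotopy (X := G) (x := e)).group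

variable {H : Type*} [Group H] [TopologicalSpace H] [IsTopologicalGroup H]

theorem HomotopyGroup.map_mul_zero (f : C(G, H)) (hf : ∀ x y, f (x * y) = f x * f y) {e : G}
    {e' : H} (h : f e = e') (a b : π_ 0 G e) :
    HomotopyGroup.map f h (a * b) = HomotopyGroup.map f h a * HomotopyGroup.map f h b := by
  have key : ∀ c : π_ 0 G e, ∀ γ : G, pi0EquivZerothHomotopy c = ZerothHomotopy.mk γ →
      pi0EquivZerothHomotopy (HomotopyGroup.map f h c) = ZerothHomotopy.mk (f γ) := by
    intro c
    induction c using Quotient.inductionOn with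
    | h c =>
      intro γ hc
      obtain ⟨p⟩ := Quotient.exact hc
      exact ZerothHomotopy.sound (p.map f.continuous)
  obtain ⟨x, hx⟩ := ZerothHomotopy.mk_surjective (pi0EquivZerothHomotopy a)
  obtain ⟨y, hy⟩ := ZerothHomotopy.mk_surjective (pi0EquivZerothHomotopy b)
  have hab : ∀ (c d : π_ 0 G e), pi0EquivZerothHomotopy (c * d) =
        pi0EquivZerothHomotopy c * pi0EquivZerothHomotopy d :=
    fun c d => Equiv.apply_symm_apply _ _
  have hab' : ∀ (c d : π_ 0 H e'), pi0EquivZerothHomotopy (c * d) =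
        pi0EquivZerothHomotopy c * pi0EquivZerothHomotopy d :=
    fun c d => Equiv.apply_symm_apply _ _
  apply pi0EquivZerothHomotopy.injective
  rw [key (a * b) (x * y) (by rw [hab, ← hx, ← hy, ZerothHomotopy.mk_mul_mk]), hab',
    key a x hx.symm, key b y hy.symm, ZerothHomotopy.mk_mul_mk, hf]

/-- The map on `π_0` induced by a continuous homomorphism, as a homomorphism of groups. -/
def HomotopyGroup.mapHomZero (f : C(G, H)) (hf : ∀ x y, f (x * y) = f x * f y) {e : G}
    {e' : H} (h : f e = e') : π_ 0 G e →* π_ 0 H e' :=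
  MonoidHom.mk' (HomotopyGroup.map f h) (HomotopyGroup.map_mul_zero f hf h)

end PiZero

/-! ### The direct systems of homotopy groups -/

namespace DirectedUnion

variable {A : Type v} [Preorder A] {M : Type u} [TopologicalSpace M] (D : DirectedUnion A M)

/-- The index set `A_p = {α ∈ A | p ∈ M_α}`. -/
abbrev IndexAt (p : M) : Type v := {α : A // p ∈ D.carrier α}

instance [IsDirectedOrder A] (p : M) : IsDirectedOrder (D.IndexAt p) where
  directed α β :=
    let ⟨γ, h₁, h₂⟩ := exists_ge_ge α.1 β.1
    ⟨⟨γ, D.mono h₁ α.2⟩, h₁, h₂⟩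

instance (p : M) : Nonempty (D.IndexAt p) :=
  let ⟨α, h⟩ := mem_iUnion.1 (D.iUnion_eq ▸ mem_univ p : p ∈ ⋃ α, D.carrier α)
  ⟨⟨α, h⟩⟩

/-- The point `p`, as a point of `M_α`. -/
def pt {p : M} (α : D.IndexAt p) : D.Step α.1 := ⟨p, α.2⟩

theorem incl_pt {p : M} (α : D.IndexAt p) : D.incl α.1 (D.pt α) = p := rfl

theorem inclusion_pt {p : M} {α β : D.IndexAt p} (h : α ≤ β) :
    D.inclusion h (D.pt α) = D.pt β := rfl

/-- Maps of sets, as a type synonym carrying the `FunLike` instance that the direct limit of a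
direct system of sets asks for. -/
def SetMap (X Y : Type*) := X → Y

instance (X Y : Type*) : FunLike (SetMap X Y) X Y where
  coe f := f
  coe_injective _ _ h := h

/-- The set (or group) `π_k(M_α, p)`. -/
abbrev PiStep (k : ℕ) (p : M) (α : D.IndexAt p) : Type u := π_ k (D.Step α.1) (D.pt α)

/-- The bonding map `π_k(M_α, p) → π_k(M_β, p)`. -/
def piBond (k : ℕ) (p : M) (α β : D.IndexAt p) (h : α ≤ β) :
    SetMap (D.PiStep k p α) (D.PiStep k p β) :=
  HomotopyGroup.map (D.inclusion h) (D.inclusion_pt h)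

/-- The map `π_k(M_α, p) → π_k(M, p)` induced by the inclusion. -/
def piIncl (k : ℕ) (p : M) (α : D.IndexAt p) : D.PiStep k p α → π_ k M p :=
  HomotopyGroup.map (D.incl α.1) (D.incl_pt α)

theorem piBond_self (k : ℕ) (p : M) (α : D.IndexAt p) (a : D.PiStep k p α) :
    D.piBond k p α α le_rfl a = a :=
  HomotopyGroup.map_id rfl a

theorem piBond_piBond (k : ℕ) (p : M) {α β γ : D.IndexAt p} (h : α ≤ β) (h' : β ≤ γ)
    (a : D.PiStep k p α) :
    D.piBond k p β γ h' (D.piBond k p α β h a) = D.piBond k p α γ (h.trans h') a :=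
  HomotopyGroup.map_map (D.inclusion h) (D.inclusion h') rfl rfl rfl a

instance (k : ℕ) (p : M) :
    DirectedSystem (D.PiStep k p) fun α β h => ⇑(D.piBond k p α β h) where
  map_self _ a := D.piBond_self k p _ a
  map_map _ _ _ h h' a := D.piBond_piBond k p h h' a

/-- The bonding map `π_{k+1}(M_α, p) → π_{k+1}(M_β, p)` as a homomorphism of groups. -/
noncomputable def piBondHom (k : ℕ) (p : M) (α β : D.IndexAt p) (h : α ≤ β) :
    D.PiStep (k + 1) p α →* D.PiStep (k + 1) p β :=
  HomotopyGroup.mapHom (D.inclusion h) (D.inclusion_pt h)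

instance (k : ℕ) (p : M) :
    DirectedSystem (D.PiStep (k + 1) p) fun α β h => D.piBondHom k p α β h where
  map_self _ a := D.piBond_self (k + 1) p _ a
  map_map _ _ _ h h' a := D.piBond_piBond (k + 1) p h h' a

/-- `M_α` carries a group structure making it a topological group (for its own topology) and
the inclusion into the group `M` a homomorphism, for each `α`. -/
class IsGroupUnion [Group M] [∀ α, Group (D.Step α)] : Prop where
  isTopologicalGroup : ∀ α, IsTopologicalGroup (D.Step α)
  incl_mul : ∀ α (x y : D.Step α), D.incl α (x * y) = D.incl α x * D.incl α y

attribute [instance] IsGroupUnion.isTopologicalGroup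

section

variable [Group M] [∀ α, Group (D.Step α)] [D.IsGroupUnion]

/-- The bonding map `π_0(M_α, 1) → π_0(M_β, 1)` as a homomorphism of groups, if `M = ⋃ α, M_α` is
a directed union of topological groups. -/
def piZeroBondHom (α β : D.IndexAt (1 : M)) (h : α ≤ β) : D.PiStep 0 1 α →* D.PiStep 0 1 β :=
  HomotopyGroup.mapHomZero (D.inclusion h)
    (fun x y => D.incl_injective β.1 <| by
      rw [incl_inclusion, IsGroupUnion.incl_mul, IsGroupUnion.incl_mul]; rfl)
    (D.inclusion_pt h)

instance :
    DirectedSystem (D.PiStep 0 (1 : M)) fun α β h => D.piZeroBondHom α β h where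
  map_self _ a := D.piBond_self 0 1 _ a
  map_map _ _ _ h h' a := D.piBond_piBond 0 1 h h' a

end

end DirectedUnion

/-! Surjectivity and injectivity of the limit map both follow from one extension principle
(`LocallyExtends.extendsNear`): given a continuous `f` from a box to `M`, a map from the boundary of
the box to some `M_α` which is close to `f` in `M` extends over the box with values in some larger
`M_β`, and the extension can be kept as close to `f` as desired.

Locally this is a cone construction in a weak direct limit chart around `q`. The chart of a large
`M_γ` carries the boundary map into a vector space, where one takes the cone with vertex the image
of `q`. Its image in `E` stays in a balanced neighbourhood translated to `φ q`, hence in the range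
of `φ`. By compactness the cone lies in the range of the chart of some `M_β`, and that chart pulls
it back. Cones need no local convexity.

Globally one bisects the box until its pieces are small, and glues: first extend to the cutting
face, which has smaller dimension, then to both halves.

For injectivity, apply the principle to a homotopy in `M`, regarded as a map on a cube of dimension
`k + 1`, with the two loops and the constant map as boundary data. For surjectivity, apply it to a
loop `γ` in `M` with constant boundary data, which yields a loop `γ'` in some `M_β` close to `γ`.
That close loops are homotopic in `M` is the same principle for the manifold `M` written as a union
with a single step. -/

/-! ### Cones over boundaries of boxes -/

section Box

variable {ι : Type*}

/-- The relative boundary of the (possibly degenerate) box `Icc a b`. -/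
def boxBoundary (a b : ι → ℝ) : Set (ι → ℝ) :=
  {x | x ∈ Icc a b ∧ ∃ i, a i < b i ∧ (x i = a i ∨ x i = b i)}

theorem isCompact_boxBoundary [Finite ι] (a b : ι → ℝ) : IsCompact (boxBoundary a b) := by
  refine isCompact_Icc.inter_right ?_
  have : {x : ι → ℝ | ∃ i, a i < b i ∧ (x i = a i ∨ x i = b i)} =
      ⋃ i, {x | a i < b i ∧ (x i = a i ∨ x i = b i)} := by ext; simp
  change IsClosed {x : ι → ℝ | ∃ i, a i < b i ∧ (x i = a i ∨ x i = b i)}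
  rw [this]
  refine isClosed_iUnion_of_finite fun i => ?_
  by_cases h : a i < b i
  · simpa only [h, true_and, ofPred_or] using
      (isClosed_eq (continuous_apply i) continuous_const).union (isClosed_eq (continuous_apply i) continuous_const)
  · simp [h]

theorem isClosed_boxBoundary [Finite ι] (a b : ι → ℝ) : IsClosed (boxBoundary a b) :=
  (isCompact_boxBoundary a b).isClosed

/-- The affine rescaling of the box `Icc a b` to the unit ball of the supremum norm; degenerate
coordinates are mapped to `0`. -/
noncomputable def boxCoord (a b x : ι → ℝ) : ι → ℝ :=
  fun i => (x i - (a i + b i) / 2) * (2 / (b i - a i))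

theorem continuous_boxCoord (a b : ι → ℝ) : Continuous (boxCoord a b) := by
  unfold boxCoord; fun_prop

/-- The radial retraction of the box `Icc a b` minus its centre onto its boundary. -/
noncomputable def boxRetract [Fintype ι] (a b x : ι → ℝ) : ι → ℝ :=
  fun i => (a i + b i) / 2 + (x i - (a i + b i) / 2) / ‖boxCoord a b x‖

theorem abs_boxCoord_le_one {a b x : ι → ℝ} (hx : x ∈ Icc a b) (i : ι) :
    |boxCoord a b x i| ≤ 1 := by
  have h₁ := hx.1 i
  have h₂ := hx.2 i
  rcases (h₁.trans h₂).eq_or_lt with h | h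
  · simp [boxCoord, h]
  · have : 0 < b i - a i := sub_pos.2 h
    rw [boxCoord, abs_le]
    constructor
    · rw [mul_div_assoc', le_div_iff₀ this]; linarith
    · rw [mul_div_assoc', div_le_iff₀ this]; linarith

theorem norm_boxCoord_le_one [Fintype ι] {a b x : ι → ℝ} (hx : x ∈ Icc a b) :
    ‖boxCoord a b x‖ ≤ 1 :=
  (pi_norm_le_iff_of_nonneg zero_le_one).2 fun i => abs_boxCoord_le_one hx i

/-- In a degenerate coordinate both sides vanish: `x i` is squeezed to the centre, and `2 / 0 = 0`.
-/
theorem sub_center_eq {a b x : ι → ℝ} (hx : x ∈ Icc a b) (i : ι) :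
    x i - (a i + b i) / 2 = boxCoord a b x i * ((b i - a i) / 2) := by
  have h₁ := hx.1 i
  have h₂ := hx.2 i
  rcases (h₁.trans h₂).eq_or_lt with h | h
  · simp only [boxCoord, h]; linarith
  · have : b i - a i ≠ 0 := (sub_pos.2 h).ne'
    simp only [boxCoord]; field_simp

theorem norm_boxCoord_of_mem_boxBoundary [Fintype ι] {a b x : ι → ℝ} (hx : x ∈ boxBoundary a b) :
    ‖boxCoord a b x‖ = 1 := by
  refine le_antisymm (norm_boxCoord_le_one hx.1) ?_
  obtain ⟨i, hi, h⟩ := hx.2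
  refine le_trans (le_of_eq ?_) (norm_le_pi_norm _ i)
  have : b i - a i ≠ 0 := (sub_pos.2 hi).ne'
  rcases h with h | h
  · have : boxCoord a b x i = -1 := by simp only [boxCoord, h]; field_simp; ring
    simp [this]
  · have : boxCoord a b x i = 1 := by simp only [boxCoord, h]; field_simp; ring
    simp [this]

theorem boxRetract_of_mem_boxBoundary [Fintype ι] {a b x : ι → ℝ} (hx : x ∈ boxBoundary a b) :
    boxRetract a b x = x := by
  ext i
  simp [boxRetract, norm_boxCoord_of_mem_boxBoundary hx]

/-- A coordinate realising the supremum norm becomes `±1` after division by the norm. It is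
nondegenerate, as degenerate coordinates rescale to `0`. -/
theorem boxRetract_mem [Fintype ι] {a b x : ι → ℝ} (hx : x ∈ Icc a b) (h : boxCoord a b x ≠ 0) :
    boxRetract a b x ∈ boxBoundary a b := by
  have hρ : 0 < ‖boxCoord a b x‖ := norm_pos_iff.2 h
  have key : ∀ i, boxRetract a b x i =
      (a i + b i) / 2 + boxCoord a b x i / ‖boxCoord a b x‖ * ((b i - a i) / 2) := by
    intro i
    simp only [boxRetract]
    rw [sub_center_eq hx i]
    ring
  have hab : ∀ i, a i ≤ b i := fun i => (hx.1 i).trans (hx.2 i)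
  have hle : ∀ i, |boxCoord a b x i / ‖boxCoord a b x‖| ≤ 1 := fun i => by
    rw [abs_div, abs_norm, div_le_one hρ]
    exact norm_le_pi_norm (boxCoord a b x) i
  refine ⟨⟨fun i => ?_, fun i => ?_⟩, ?_⟩
  · rw [key]
    have := (abs_le.1 (hle i)).1
    nlinarith [hab i]
  · rw [key]
    have := (abs_le.1 (hle i)).2
    nlinarith [hab i]
  · have : Nonempty ι := by
      by_contra hι
      rw [not_nonempty_iff] at hι
      exact h (Subsingleton.elim _ _)
    obtain ⟨i, -, hi⟩ := Finset.exists_mem_eq_sup' (Finset.univ_nonempty (α := ι))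
      (fun i => ‖boxCoord a b x i‖)
    have hi' : ‖boxCoord a b x‖ = |boxCoord a b x i| := by
      refine le_antisymm ((pi_norm_le_iff_of_nonempty _).2 fun j => ?_)
        (norm_le_pi_norm (boxCoord a b x) i)
      rw [← Real.norm_eq_abs, ← hi]
      exact Finset.le_sup' (fun i => ‖boxCoord a b x i‖) (Finset.mem_univ j)
    have hne : boxCoord a b x i ≠ 0 := by
      intro h0
      rw [h0, abs_zero] at hi'
      exact hρ.ne' hi'
    refine ⟨i, (hab i).lt_of_ne fun h' => hne (by simp [boxCoord, h']), ?_⟩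
    rw [key, hi']
    rcases lt_or_gt_of_ne hne with h' | h'
    · left
      rw [abs_of_neg h', div_neg, div_self hne]; ring
    · right
      rw [abs_of_pos h', div_self hne]; ring

theorem continuousAt_boxRetract [Fintype ι] {a b x : ι → ℝ} (h : boxCoord a b x ≠ 0) :
    ContinuousAt (boxRetract a b) x := by
  refine continuousAt_pi.2 fun i => ?_
  have h₁ : ContinuousAt (fun x => ‖boxCoord a b x‖) x :=
    (continuous_boxCoord a b).norm.continuousAt
  unfold boxRetract
  exact continuousAt_const.add (ContinuousAt.div
    (((continuous_apply i).sub continuous_const).continuousAt) h₁ (norm_ne_zero_iff.2 h))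

/-- A map on the boundary of a box extends to the box as a cone with a given vertex. -/
theorem exists_cone_extension [Fintype ι] {E : Type*} [AddCommGroup E] [Module ℝ E]
    [TopologicalSpace E] [IsTopologicalAddGroup E] [ContinuousSMul ℝ E] (a b : ι → ℝ)
    (h : (ι → ℝ) → E) (hh : ContinuousOn h (boxBoundary a b)) (v : E) :
    ∃ H : (ι → ℝ) → E, ContinuousOn H (Icc a b) ∧ EqOn H h (boxBoundary a b) ∧
      ∀ x ∈ Icc a b, H x = v ∨ ∃ t ∈ Icc (0 : ℝ) 1, ∃ y ∈ boxBoundary a b,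
        H x = v + t • (h y - v) := by
  classical
  refine ⟨fun x => v + ‖boxCoord a b x‖ • (h (boxRetract a b x) - v), ?_, ?_, ?_⟩
  · intro x hx
    have hn : ContinuousAt (fun x => ‖boxCoord a b x‖) x :=
      (continuous_boxCoord a b).norm.continuousAt
    by_cases h0 : boxCoord a b x = 0
    · refine ContinuousWithinAt.add continuousWithinAt_const ?_
      rw [ContinuousWithinAt, h0, norm_zero, zero_smul]
      -- At the centre the radial direction has no limit, but `h - v` ranges over a compact, hence
      -- bounded, set, and the scalar factor tends to `0`. The value `0` at the centre, where the
      -- retraction is meaningless, keeps `g` bounded without changing the product.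
      let g : (ι → ℝ) → E := fun x =>
        if boxCoord a b x = 0 then 0 else h (boxRetract a b x) - v
      have hb : Bornology.IsVonNBounded ℝ (insert 0 ((fun y => h y - v) '' boxBoundary a b)) :=
        ((((isCompact_boxBoundary a b).image_of_continuousOn
          (hh.sub continuousOn_const)).insert 0)).isVonNBounded ℝ
      have hg : ∀ᶠ x in 𝓝[Icc a b] x, g x ∈ insert 0 ((fun y => h y - v) '' boxBoundary a b) := by
        filter_upwards [self_mem_nhdsWithin] with y hy
        by_cases h1 : boxCoord a b y = 0
        · simp [g, h1]
        · simp only [g, h1, if_false]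
          exact Or.inr ⟨_, boxRetract_mem hy h1, rfl⟩
      have ht := hb.smul_tendsto_zero hg (ε := fun x => ‖boxCoord a b x‖) (by
        have := hn.tendsto
        rw [h0, norm_zero] at this
        exact this.mono_left nhdsWithin_le_nhds)
      refine ht.congr fun y => ?_
      by_cases h1 : boxCoord a b y = 0 <;> simp [g, h1]
    · refine ContinuousWithinAt.add continuousWithinAt_const
        (hn.continuousWithinAt.smul (ContinuousWithinAt.sub ?_ continuousWithinAt_const))
      have hU : {y | boxCoord a b y ≠ 0} ∈ 𝓝 x :=
        (isOpen_ne.preimage (continuous_boxCoord a b)).mem_nhds h0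
      have h2 : ContinuousWithinAt (fun y => h (boxRetract a b y))
          (Icc a b ∩ {y | boxCoord a b y ≠ 0}) x :=
        ContinuousWithinAt.comp (t := boxBoundary a b) (hh _ (boxRetract_mem hx h0))
          (continuousAt_boxRetract h0).continuousWithinAt fun y hy => boxRetract_mem hy.1 hy.2
      exact (continuousWithinAt_inter hU).1 h2
  · intro x hx
    simp [norm_boxCoord_of_mem_boxBoundary hx, boxRetract_of_mem_boxBoundary hx]
  · intro x hx
    by_cases h0 : boxCoord a b x = 0
    · left; simp [h0]
    · right
      exact ⟨_, ⟨norm_nonneg _, norm_boxCoord_le_one hx⟩, _, boxRetract_mem hx h0, rfl⟩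

end Box

/-! ### Linear maps and open sets -/

section Linear

variable {E F : Type*} [AddCommGroup E] [Module ℝ E] [TopologicalSpace E] [ContinuousAdd E]
  [ContinuousSMul ℝ E] [AddCommGroup F] [Module ℝ F]

theorem exists_pos_add_smul_mem {s : Set E} (hs : IsOpen s) {v : E} (hv : v ∈ s) (x : E) :
    ∃ t : ℝ, t ≠ 0 ∧ v + t • x ∈ s := by
  have hc : Continuous fun t : ℝ => v + t • x := by fun_prop
  have h1 : ∀ᶠ t in 𝓝 (0 : ℝ), v + t • x ∈ s :=
    hc.continuousAt.eventually_mem (hs.mem_nhds (by simpa using hv))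
  obtain ⟨t, ht, h0⟩ := ((h1.filter_mono nhdsWithin_le_nhds).and
    (self_mem_nhdsWithin : {(0 : ℝ)}ᶜ ∈ 𝓝[≠] (0 : ℝ))).exists
  exact ⟨t, h0, ht⟩

/-- A linear map that is injective on a nonempty open set is injective. -/
theorem LinearMap.injective_of_injOn_isOpen (f : E →ₗ[ℝ] F) {s : Set E} (hs : IsOpen s)
    (hne : s.Nonempty) (hf : InjOn f s) : Function.Injective f := by
  refine (injective_iff_map_eq_zero f).2 fun x hx => ?_
  obtain ⟨v, hv⟩ := hne
  obtain ⟨t, ht, hm⟩ := exists_pos_add_smul_mem hs hv x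
  have := hf hm hv (by simp [hx])
  simpa [ht] using this

/-- Linear maps that agree on a nonempty open set are equal. -/
theorem LinearMap.eq_of_eqOn_isOpen (f g : E →ₗ[ℝ] F) {s : Set E} (hs : IsOpen s)
    (hne : s.Nonempty) (hf : EqOn f g s) : f = g := by
  ext x
  obtain ⟨v, hv⟩ := hne
  obtain ⟨t, ht, hm⟩ := exists_pos_add_smul_mem hs hv x
  have h := hf hm
  rw [map_add, map_add, hf hv, map_smul, map_smul] at h
  exact smul_right_injective F ht (add_left_cancel h)

end Linear

/-- If each point of a compact set `K` satisfies one of the conditions `h i x ∈ V i`, which are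
open and weaken along a directed index set, then all points of `K` satisfy the same one. -/
theorem IsCompact.exists_forall_of_directed {X I : Type*} [TopologicalSpace X] [Nonempty I]
    [Preorder I] [IsDirectedOrder I] {K : Set X} (hK : IsCompact K) {Y : I → Type*}
    [∀ i, TopologicalSpace (Y i)] (h : ∀ i, X → Y i) (hc : ∀ i, ContinuousOn (h i) K)
    (V : ∀ i, Set (Y i)) (hV : ∀ i, IsOpen (V i))
    (hmono : ∀ i j, i ≤ j → ∀ x ∈ K, h i x ∈ V i → h j x ∈ V j)
    (hcov : ∀ x ∈ K, ∃ i, h i x ∈ V i) : ∃ i, ∀ x ∈ K, h i x ∈ V i := by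
  have : CompactSpace K := isCompact_iff_compactSpace.1 hK
  obtain ⟨i, hi⟩ := (isCompact_univ (X := K)).elim_directed_cover
    (fun i => {x : K | h i x ∈ V i})
    (fun i => (hV i).preimage (hc i).domRestrict)
    (fun x _ => mem_iUnion.2 (hcov x.1 x.2))
    (directed_of_isDirected_le fun i j hij x hx => hmono i j hij x.1 x.2 hx)
  exact ⟨i, fun x hx => hi (mem_univ (⟨x, hx⟩ : K))⟩

/-! ### Local extension of maps from boundaries of boxes -/

namespace DirectedUnion

variable {A : Type v} [Preorder A] {M : Type u} [TopologicalSpace M] (D : DirectedUnion A M)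

/-- Arbitrarily small open neighbourhoods `O` of each point of `M` have the property that each map
from the boundary of a box to some `M_α` with values in `O` extends to a map from the box to some
`M_β` with values in `O`. -/
def LocallyExtends : Prop :=
  ∀ (q : M), ∀ N ∈ 𝓝 q, ∃ O : Set M, IsOpen O ∧ q ∈ O ∧ O ⊆ N ∧
    ∀ (k : ℕ) (a b : Fin k → ℝ) (α : A) (g : (Fin k → ℝ) → D.Step α),
      ContinuousOn g (boxBoundary a b) → (∀ x ∈ boxBoundary a b, D.incl α (g x) ∈ O) →
      ∃ (β : A) (h : α ≤ β) (g' : (Fin k → ℝ) → D.Step β), ContinuousOn g' (Icc a b) ∧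
        (∀ x ∈ boxBoundary a b, g' x = D.inclusion h (g x)) ∧ ∀ x ∈ Icc a b, D.incl β (g' x) ∈ O

variable {D}

/-- The cone is formed in a single space `F γ` and is only afterwards moved to larger indices by the
linear bonding maps. Points of the spaces `F β` are compared through their images in `E`, which is
legitimate because the maps `l β` are injective. -/
theorem _root_.AdmitsWeakDirectLimitCharts.locallyExtends [IsDirectedOrder A]
    (hD : AdmitsWeakDirectLimitCharts.{u, v, w} D) : D.LocallyExtends := by
  intro q N hN
  obtain ⟨E, φ, hq, α₀, F, ψ, l, m, ha, hb, hc⟩ := hD q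
  obtain ⟨W, hWo, hW0, hWb, hWt⟩ : ∃ W : Set E, IsOpen W ∧ 0 ∈ W ∧ Balanced ℝ W ∧
      ∀ e, e - φ q ∈ W → e ∈ φ.target ∧ φ.symm e ∈ N := by
    have h1 : ∀ᶠ e in 𝓝 (φ q), e ∈ φ.target ∧ φ.symm e ∈ N := by
      refine (φ.open_target.eventually_mem (φ.map_source hq)).and ?_
      exact (φ.tendsto_symm hq).eventually_mem hN
    have h2 : ∀ᶠ x in 𝓝 (0 : E), x + φ q ∈ φ.target ∧ φ.symm (x + φ q) ∈ N := by
      have hc : Continuous fun x : E => x + φ q := by fun_prop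
      have := hc.tendsto 0
      rw [zero_add] at this
      exact this.eventually h1
    obtain ⟨W, ⟨hW, hWb⟩, hWs⟩ := (nhds_basis_balanced ℝ E).mem_iff.1 h2
    have h0 := mem_interior_iff_mem_nhds.2 hW
    refine ⟨interior W, isOpen_interior, h0, hWb.interior h0, fun e he => ?_⟩
    simpa using hWs (interior_subset he)
  set O : Set M := φ.source ∩ φ ⁻¹' ((fun e => e - φ q) ⁻¹' W) with hO
  refine ⟨O, φ.isOpen_inter_preimage (hWo.preimage (by fun_prop)), ⟨hq, by simpa using hW0⟩,
    fun x hx => by simpa [φ.left_inv hx.1] using (hWt _ hx.2).2, ?_⟩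
  intro k a b α g hg hgO
  -- the indices from which on the chart domains contain `q`
  obtain ⟨α₁, q₁, hq₁, rfl⟩ := mem_iUnion.1 (hc ▸ hq)
  let I := {β : Ici α₀ // α₁ ≤ β ∧ α ≤ β.1}
  have hI : Nonempty I := by
    obtain ⟨β, h₁, h₂⟩ := exists_ge_ge α₁.1 α
    exact ⟨⟨⟨β, le_trans α₁.2 h₁⟩, h₁, h₂⟩⟩
  have hdir : IsDirectedOrder I := ⟨fun β γ => by
    obtain ⟨δ, h₁, h₂⟩ := exists_ge_ge β.1.1 γ.1.1
    exact ⟨⟨⟨δ, le_trans β.1.2 h₁⟩, le_trans β.2.1 h₁, le_trans β.2.2 h₁⟩, h₁, h₂⟩⟩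
  have hqI : ∀ β : I, D.inclusion β.2.1 q₁ ∈ (ψ β.1).source := fun β => (hb _ _ β.2.1 _ hq₁).1
  have hne : ∀ β : I, (ψ β.1).target.Nonempty := fun β => ⟨_, (ψ β.1).map_source (hqI β)⟩
  have hla : ∀ β : I, ∀ y ∈ (ψ β.1).target,
      l β.1 y = φ (D.incl β.1 ((ψ β.1).symm y)) := fun β y hy => by
    rw [(ha β.1 _ ((ψ β.1).map_target hy)).2, (ψ β.1).right_inv hy]
  -- On the range of the chart, `l β` is a composition of injective maps; the range is open and,
  -- since it contains the image of `q`, nonempty.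
  have hlinj : ∀ β : I, Function.Injective (l β.1) := fun β => by
    refine LinearMap.injective_of_injOn_isOpen (l β.1 : F β.1 →ₗ[ℝ] E) (ψ β.1).open_target (hne β)
      fun y hy z hz hyz => ?_
    have hyz' : l β.1 y = l β.1 z := hyz
    rw [hla β y hy, hla β z hz] at hyz'
    exact (ψ β.1).symm.injOn hy hz (D.incl_injective _ (φ.injOn
      (ha β.1 _ ((ψ β.1).map_target hy)).1 (ha β.1 _ ((ψ β.1).map_target hz)).1 hyz'))
  -- Compatibility of the linear maps is not part of the definition of a weak direct limit chart; it
  -- holds on the range of the chart by (a) and (b), hence everywhere by linearity.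
  have hlm : ∀ (β γ : I) (h : β ≤ γ) (y : F β.1), l γ.1 (m β.1 γ.1 h y) = l β.1 y := by
    intro β γ h y
    have := LinearMap.eq_of_eqOn_isOpen ((l γ.1).comp (m β.1 γ.1 h) : F β.1 →ₗ[ℝ] E)
      (l β.1 : F β.1 →ₗ[ℝ] E) (ψ β.1).open_target (hne β) fun y hy => ?_
    · exact DFunLike.congr_fun this y
    · have h1 := hb β.1 γ.1 h _ ((ψ β.1).map_target hy)
      rw [(ψ β.1).right_inv hy] at h1
      change l γ.1 (m β.1 γ.1 h y) = l β.1 y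
      rw [← h1.2, ← (ha γ.1 _ h1.1).2, hla β y hy]
      rfl
  -- the given map takes its values in the domain of a chart
  obtain ⟨γ, hγ⟩ : ∃ γ : I, ∀ x ∈ boxBoundary a b, D.inclusion γ.2.2 (g x) ∈ (ψ γ.1).source := by
    refine (isCompact_boxBoundary a b).exists_forall_of_directed
      (fun γ : I => fun x => D.inclusion γ.2.2 (g x))
      (fun γ => (D.inclusion γ.2.2).continuous.comp_continuousOn hg) _
      (fun γ => (ψ γ.1).open_source) (fun β γ h x _ hx => (hb β.1 γ.1 h _ hx).1) fun x hx => ?_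
    obtain ⟨δ, y, hy, hyx⟩ := mem_iUnion.1 (hc ▸ (hgO x hx).1)
    obtain ⟨γ⟩ := hI
    obtain ⟨ε, h₁, h₂⟩ := exists_ge_ge γ.1.1 δ.1
    refine ⟨⟨⟨ε, le_trans γ.1.2 h₁⟩, le_trans γ.2.1 h₁, le_trans γ.2.2 h₁⟩, ?_⟩
    have := (hb δ ⟨ε, le_trans γ.1.2 h₁⟩ h₂ y hy).1
    convert! this using 1
    exact D.incl_injective _ hyx.symm
  have hφq : φ (D.incl α₁ q₁) = l γ.1 (ψ γ.1 (D.inclusion γ.2.1 q₁)) := (ha γ.1 _ (hqI γ)).2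
  obtain ⟨H, hHc, hHb, hHv⟩ := exists_cone_extension a b
    (fun x => ψ γ.1 (D.inclusion γ.2.2 (g x)))
    ((ψ γ.1).continuousOn.comp ((D.inclusion γ.2.2).continuous.comp_continuousOn hg) hγ)
    (ψ γ.1 (D.inclusion γ.2.1 q₁))
  -- `l γ` is linear, so it sends the cone to segments issuing from `φ q`; their end points differ
  -- from `φ q` by elements of the balanced set `W`.
  have hHW : ∀ x ∈ Icc a b, l γ.1 (H x) - φ (D.incl α₁ q₁) ∈ W := by
    intro x hx
    rcases hHv x hx with h | ⟨t, ht, y, hy, h⟩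
    · rw [h, hφq, sub_self]; exact hW0
    · rw [h, hφq, map_add, add_sub_cancel_left, map_smul, map_sub, ← hφq,
        ← (ha γ.1 _ (hγ y hy)).2]
      exact hWb.smul_mem (by rw [Real.norm_eq_abs, abs_le]; exact ⟨by linarith [ht.1], ht.2⟩)
        (hgO y hy).2
  -- the cone takes its values in the range of a chart
  let J := {β : I // γ ≤ β}
  have hJ : Nonempty J := ⟨⟨γ, le_rfl⟩⟩
  have hdirJ : IsDirectedOrder J := ⟨fun β δ => by
    obtain ⟨ε, h₁, h₂⟩ := exists_ge_ge β.1 δ.1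
    exact ⟨⟨ε, β.2.trans h₁⟩, h₁, h₂⟩⟩
  obtain ⟨β, hβ⟩ : ∃ β : J, ∀ x ∈ Icc a b, m γ.1 β.1.1 β.2 (H x) ∈ (ψ β.1.1).target := by
    refine (isCompact_Icc (a := a) (b := b)).exists_forall_of_directed
      (fun β : J => fun x => m γ.1 β.1.1 β.2 (H x))
      (fun β => (m γ.1 β.1.1 β.2).continuous.comp_continuousOn hHc) _
      (fun β => (ψ β.1.1).open_target) (fun β δ h x _ hx => ?_) fun x hx => ?_
    · have h1 := hb β.1.1 δ.1.1 h _ ((ψ β.1.1).map_target hx)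
      have h2 := (ψ δ.1.1).map_source h1.1
      rw [h1.2, (ψ β.1.1).right_inv hx] at h2
      convert! h2 using 1
      -- Transitivity of the maps `m` is not assumed either; it is checked after applying the
      -- injective `l δ`.
      apply hlinj δ.1
      rw [hlm γ δ.1 δ.2, hlm β.1 δ.1 h, hlm γ β.1 β.2]
    -- The point of `M` with coordinate `l γ (H x)` lies in the chart domain of some `M_δ` by (c).
    -- For `ε` above `γ` and `δ`, its coordinate in `F ε` must be the image of `H x`, as both have
    -- the same image in `E`.
    · have h1 := (hWt _ (hHW x hx)).1
      have h2 := φ.map_target h1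
      rw [hc] at h2
      obtain ⟨δ, y, hy, hyx⟩ := mem_iUnion.1 h2
      obtain ⟨ε, h₁, h₂⟩ := exists_ge_ge γ.1.1 δ.1
      have hε : α₀ ≤ ε := le_trans γ.1.2 h₁
      let ε' : I := ⟨⟨ε, hε⟩, le_trans γ.2.1 h₁, le_trans γ.2.2 h₁⟩
      refine ⟨⟨ε', h₁⟩, ?_⟩
      have h3 := (hb δ ε'.1 h₂ y hy).1
      have h4 := (ψ ε'.1).map_source h3
      convert! h4 using 1
      apply hlinj ε'
      rw [hlm γ ε' h₁, ← (ha ε'.1 _ h3).2, incl_inclusion, hyx, φ.right_inv h1]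
  refine ⟨β.1.1.1, β.1.2.2, fun x => (ψ β.1.1).symm (m γ.1 β.1.1 β.2 (H x)), ?_, ?_, ?_⟩
  · exact (ψ β.1.1).continuousOn_symm.comp ((m γ.1 β.1.1 β.2).continuous.comp_continuousOn hHc) hβ
  · intro x hx
    have h1 := hb γ.1 β.1.1 β.2 _ (hγ x hx)
    simp only
    rw [hHb hx, ← h1.2, (ψ β.1.1).left_inv h1.1]
    rfl
  · intro x hx
    have h1 := ha β.1.1 _ ((ψ β.1.1).map_target (hβ x hx))
    refine ⟨h1.1, ?_⟩
    rw [mem_preimage, h1.2, (ψ β.1.1).right_inv (hβ x hx), mem_preimage, hlm γ β.1 β.2]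
    exact hHW x hx

end DirectedUnion

/-! ### Extension of maps close to a given one -/

section Bisection

variable {ι : Type*} [DecidableEq ι]

/-- A property of boxes inherited from the two halves of a box holds for all boxes if it holds for
all small ones. -/
theorem box_bisection_induction [Fintype ι] {a₀ b₀ : ι → ℝ} {P : (ι → ℝ) → (ι → ℝ) → Prop}
    {δ : ℝ} (hδ : 0 < δ)
    (small : ∀ a b, a₀ ≤ a → a ≤ b → b ≤ b₀ → (∀ i, b i - a i < δ) → P a b)
    (split : ∀ a b i, a₀ ≤ a → a ≤ b → b ≤ b₀ → a i < b i →
      P a (Function.update b i ((a i + b i) / 2)) → P (Function.update a i ((a i + b i) / 2)) b →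
      P a b)
    (a b : ι → ℝ) (ha : a₀ ≤ a) (hab : a ≤ b) (hb : b ≤ b₀) : P a b := by
  -- `s` contains the coordinates in which the box may still be long. One of them is removed at a
  -- time, by repeatedly halving its side, which is below `δ * 2 ^ n`.
  suffices H : ∀ s : Finset ι, ∀ a b, a₀ ≤ a → a ≤ b → b ≤ b₀ →
      (∀ i ∉ s, b i - a i < δ) → P a b from
    H Finset.univ a b ha hab hb fun i hi => absurd (Finset.mem_univ i) hi
  intro s
  induction s using Finset.induction_on with
  | empty => exact fun a b ha hab hb h => small a b ha hab hb fun i => h i (Finset.notMem_empty i)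
  | insert i s his ih =>
    suffices H : ∀ (n : ℕ) (a b : ι → ℝ), a₀ ≤ a → a ≤ b → b ≤ b₀ → b i - a i < δ * 2 ^ n →
        (∀ j ∉ insert i s, b j - a j < δ) → P a b by
      intro a b ha hab hb h
      obtain ⟨n, hn⟩ := pow_unbounded_of_one_lt ((b i - a i) / δ) (one_lt_two (α := ℝ))
      exact H n a b ha hab hb (by rwa [div_lt_iff₀' hδ] at hn) h
    intro n
    induction n with
    | zero =>
      refine fun a b ha hab hb hi h => ih a b ha hab hb fun j hj => ?_
      by_cases hji : j = i
      · subst hji; simpa using hi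
      · exact h j (by simp [hji, hj])
    | succ n ihn =>
      intro a b ha hab hb hi h
      rcases (hab i).eq_or_lt with hlt | hlt
      · refine ihn a b ha hab hb ?_ h
        rw [hlt, sub_self]; positivity
      have hac : a i ≤ (a i + b i) / 2 := by linarith
      have hcb : (a i + b i) / 2 ≤ b i := by linarith
      have hu : Function.update b i ((a i + b i) / 2) ≤ b := by
        simpa [update_le_iff] using hcb
      have hl : a ≤ Function.update a i ((a i + b i) / 2) := by
        simpa [le_update_iff] using hac
      refine split a b i ha hab hb hlt (ihn _ _ ha ?_ (hu.trans hb) ?_ ?_)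
        (ihn _ _ (ha.trans hl) ?_ hb ?_ ?_)
      · simpa [le_update_iff] using ⟨hac, fun j _ => hab j⟩
      · rw [Function.update_self]; rw [pow_succ] at hi; linarith
      · intro j hj
        have hji : j ≠ i := fun e => hj (by simp [e])
        simpa [hji] using h j hj
      · simpa [update_le_iff] using ⟨hcb, fun j _ => hab j⟩
      · rw [Function.update_self]; rw [pow_succ] at hi; linarith
      · intro j hj
        have hji : j ≠ i := fun e => hj (by simp [e])
        simpa [hji] using h j hj

variable {a b x : ι → ℝ} {i : ι} {c : ℝ}

theorem mem_Icc_lowerHalf (hc : c ≤ b i) :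
    x ∈ Icc a (Function.update b i c) ↔ x ∈ Icc a b ∧ x i ≤ c := by
  simp only [mem_Icc, le_update_iff]
  refine ⟨fun h => ⟨⟨h.1, fun j => ?_⟩, h.2.1⟩, fun h => ⟨h.1.1, h.2, fun j _ => h.1.2 j⟩⟩
  by_cases hj : j = i
  · subst hj; exact h.2.1.trans hc
  · exact h.2.2 j hj

theorem mem_Icc_upperHalf (hc : a i ≤ c) :
    x ∈ Icc (Function.update a i c) b ↔ x ∈ Icc a b ∧ c ≤ x i := by
  simp only [mem_Icc, update_le_iff]
  refine ⟨fun h => ⟨⟨fun j => ?_, h.2⟩, h.1.1⟩, fun h => ⟨⟨h.2, fun j _ => h.1.1 j⟩, h.1.2⟩⟩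
  by_cases hj : j = i
  · subst hj; exact hc.trans h.1.1
  · exact h.1.2 j hj

theorem mem_Icc_slice (hac : a i ≤ c) (hcb : c ≤ b i) :
    x ∈ Icc (Function.update a i c) (Function.update b i c) ↔ x ∈ Icc a b ∧ x i = c := by
  rw [mem_Icc_lowerHalf hcb, mem_Icc_upperHalf hac, and_assoc, le_antisymm_iff,
    and_comm (a := c ≤ _)]

/-- Coordinate `i` is degenerate in the slice, so it does not contribute to the relative boundary
there; in the large box `x i = c` is an interior value. -/
theorem mem_boxBoundary_slice (hac : a i < c) (hcb : c < b i) :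
    x ∈ boxBoundary (Function.update a i c) (Function.update b i c) ↔
      x ∈ boxBoundary a b ∧ x i = c := by
  simp only [boxBoundary, mem_ofPred_eq, mem_Icc_slice hac.le hcb.le]
  constructor
  · rintro ⟨⟨hx, hxi⟩, j, hj, hxj⟩
    have hji : j ≠ i := fun e => by subst e; simp at hj
    simp only [ne_eq, hji, not_false_eq_true, Function.update_of_ne] at hj hxj
    exact ⟨⟨hx, j, hj, hxj⟩, hxi⟩
  · rintro ⟨⟨hx, j, hj, hxj⟩, hxi⟩
    have hji : j ≠ i := fun e => by
      subst e
      rcases hxj with h | h <;> linarith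
    exact ⟨⟨hx, hxi⟩, j, by simpa [hji] using hj, by simpa [hji] using hxj⟩

theorem boxBoundary_lowerHalf_subset (hac : a i < c) (hcb : c < b i) :
    boxBoundary a (Function.update b i c) ⊆
      boxBoundary a b ∪ Icc (Function.update a i c) (Function.update b i c) := by
  rintro x ⟨hx, j, hj, hxj⟩
  rw [mem_union, mem_Icc_slice hac.le hcb.le]
  have hx' := (mem_Icc_lowerHalf hcb.le).1 hx
  by_cases hji : j = i
  · subst hji
    rcases hxj with h | h
    · exact Or.inl ⟨hx'.1, j, hac.trans hcb, Or.inl h⟩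
    · exact Or.inr ⟨hx'.1, by simpa using h⟩
  · exact Or.inl ⟨hx'.1, j, by simpa [hji] using hj, by simpa [hji] using hxj⟩

theorem boxBoundary_upperHalf_subset (hac : a i < c) (hcb : c < b i) :
    boxBoundary (Function.update a i c) b ⊆
      boxBoundary a b ∪ Icc (Function.update a i c) (Function.update b i c) := by
  rintro x ⟨hx, j, hj, hxj⟩
  rw [mem_union, mem_Icc_slice hac.le hcb.le]
  have hx' := (mem_Icc_upperHalf hac.le).1 hx
  by_cases hji : j = i
  · subst hji
    rcases hxj with h | h
    · exact Or.inr ⟨hx'.1, by simpa using h⟩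
    · exact Or.inl ⟨hx'.1, j, hac.trans hcb, Or.inr h⟩
  · exact Or.inl ⟨hx'.1, j, by simpa [hji] using hj, by simpa [hji] using hxj⟩

end Bisection

namespace DirectedUnion

variable {A : Type v} [Preorder A] {M : Type u} [TopologicalSpace M] (D : DirectedUnion A M)
  {k : ℕ}

/-- Maps from the boundary of the box `Icc a b` to some `M_α` that are sufficiently close to `f`
extend to maps from the box to some `M_β` whose graph is contained in `W`. -/
def ExtendsNear (f : (Fin k → ℝ) → M) (W : Set ((Fin k → ℝ) × M)) (a b : Fin k → ℝ) : Prop :=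
  ∃ W' : Set ((Fin k → ℝ) × M), IsOpen W' ∧ (∀ x ∈ Icc a b, (x, f x) ∈ W') ∧
    ∀ (α : A) (g : (Fin k → ℝ) → D.Step α), ContinuousOn g (boxBoundary a b) →
      (∀ x ∈ boxBoundary a b, (x, D.incl α (g x)) ∈ W') →
      ∃ (β : A) (h : α ≤ β) (g' : (Fin k → ℝ) → D.Step β), ContinuousOn g' (Icc a b) ∧
        (∀ x ∈ boxBoundary a b, g' x = D.inclusion h (g x)) ∧
        ∀ x ∈ Icc a b, (x, D.incl β (g' x)) ∈ W

variable {D} {f : (Fin k → ℝ) → M} {W : Set ((Fin k → ℝ) × M)} {a b : Fin k → ℝ}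

/-- The extension to the cutting face is required to satisfy the closeness conditions of both
halves, so that it can serve as boundary data for each. The extensions are made in succession, each
starting in the step reached by the previous one. -/
theorem ExtendsNear.of_halves {i : Fin k} {c : ℝ} (hac : a i < c) (hcb : c < b i)
    (h₁ : D.ExtendsNear f W a (Function.update b i c))
    (h₂ : D.ExtendsNear f W (Function.update a i c) b)
    (hF : ∀ V : Set ((Fin k → ℝ) × M), IsOpen V →
      (∀ x ∈ Icc (Function.update a i c) (Function.update b i c), (x, f x) ∈ V) →
      D.ExtendsNear f V (Function.update a i c) (Function.update b i c)) :
    D.ExtendsNear f W a b := by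
  classical
  obtain ⟨W₁, hW₁, hf₁, e₁⟩ := h₁
  obtain ⟨W₂, hW₂, hf₂, e₂⟩ := h₂
  set Q₁ := Icc a (Function.update b i c)
  set Q₂ := Icc (Function.update a i c) b
  set Q₀ := Icc (Function.update a i c) (Function.update b i c)
  have m₁ : ∀ {x}, x ∈ Q₁ ↔ x ∈ Icc a b ∧ x i ≤ c := mem_Icc_lowerHalf hcb.le
  have m₂ : ∀ {x}, x ∈ Q₂ ↔ x ∈ Icc a b ∧ c ≤ x i := mem_Icc_upperHalf hac.le
  have m₀ : ∀ {x}, x ∈ Q₀ ↔ x ∈ Icc a b ∧ x i = c := mem_Icc_slice hac.le hcb.le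
  have h01 : Q₀ ⊆ Q₁ := fun x hx => m₁.2 ⟨(m₀.1 hx).1, (m₀.1 hx).2.le⟩
  have h02 : Q₀ ⊆ Q₂ := fun x hx => m₂.2 ⟨(m₀.1 hx).1, (m₀.1 hx).2.ge⟩
  obtain ⟨W₀, hW₀, hf₀, e₀⟩ := hF (W₁ ∩ W₂) (hW₁.inter hW₂)
    fun x hx => ⟨hf₁ x (h01 hx), hf₂ x (h02 hx)⟩
  have hop : ∀ {Q : Set (Fin k → ℝ)} {V : Set ((Fin k → ℝ) × M)}, IsClosed Q → IsOpen V →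
      IsOpen (V ∪ Prod.fst ⁻¹' Qᶜ) := fun hQ hV =>
    hV.union (hQ.isOpen_compl.preimage continuous_fst)
  have himp : ∀ {Q : Set (Fin k → ℝ)} {V : Set ((Fin k → ℝ) × M)} {x : Fin k → ℝ} {y : M},
      (x, y) ∈ V ∪ Prod.fst ⁻¹' Qᶜ → x ∈ Q → (x, y) ∈ V := fun h hx =>
    h.resolve_right fun h => h hx
  have himp' : ∀ {Q : Set (Fin k → ℝ)} {V : Set ((Fin k → ℝ) × M)} {x : Fin k → ℝ} {y : M},
      (x ∈ Q → (x, y) ∈ V) → (x, y) ∈ V ∪ Prod.fst ⁻¹' Qᶜ := fun {Q V x y} h => by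
    by_cases hx : x ∈ Q
    · exact Or.inl (h hx)
    · exact Or.inr hx
  -- Each closeness condition is imposed only over its own closed piece; adding everything over the
  -- complement keeps the set open.
  refine ⟨((W₁ ∪ Prod.fst ⁻¹' Q₁ᶜ) ∩ (W₂ ∪ Prod.fst ⁻¹' Q₂ᶜ)) ∩ (W₀ ∪ Prod.fst ⁻¹' Q₀ᶜ),
    ((hop isClosed_Icc hW₁).inter (hop isClosed_Icc hW₂)).inter (hop isClosed_Icc hW₀),
    fun x _ => ⟨⟨himp' (hf₁ x), himp' (hf₂ x)⟩, himp' (hf₀ x)⟩, ?_⟩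
  intro α g hg hgW
  have hb₀ : ∀ {x}, x ∈ boxBoundary (Function.update a i c) (Function.update b i c) ↔
      x ∈ boxBoundary a b ∧ x i = c := mem_boxBoundary_slice hac hcb
  -- extension to the common face
  obtain ⟨β, hβ, g₀, hg₀, hg₀b, hg₀W⟩ := e₀ α g (hg.mono fun x hx => (hb₀.1 hx).1)
    fun x hx => himp (hgW x (hb₀.1 hx).1).2 hx.1
  let G : (Fin k → ℝ) → D.Step β := fun x => if x ∈ Q₀ then g₀ x else D.inclusion hβ (g x)
  have hG₀ : EqOn G g₀ Q₀ := fun x hx => if_pos hx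
  have hGg : EqOn G (fun x => D.inclusion hβ (g x)) (boxBoundary a b) := fun x hx => by
    by_cases hx₀ : x ∈ Q₀
    · exact (if_pos hx₀).trans (hg₀b x (hb₀.2 ⟨hx, (m₀.1 hx₀).2⟩))
    · exact if_neg hx₀
  have hGc : ContinuousOn G (boxBoundary a b ∪ Q₀) :=
    (((D.inclusion hβ).continuous.comp_continuousOn hg).congr hGg).union_of_isClosed
      (hg₀.congr hG₀) (isClosed_boxBoundary a b) isClosed_Icc
  have hGW : ∀ x ∈ boxBoundary a b ∪ Q₀, (x ∈ Q₁ → (x, D.incl β (G x)) ∈ W₁) ∧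
      (x ∈ Q₂ → (x, D.incl β (G x)) ∈ W₂) := by
    rintro x (hx | hx)
    · rw [hGg hx]
      exact ⟨himp (hgW x hx).1.1, himp (hgW x hx).1.2⟩
    · rw [hG₀ hx]
      exact ⟨fun _ => (hg₀W x hx).1, fun _ => (hg₀W x hx).2⟩
  have s₁ := boxBoundary_lowerHalf_subset hac hcb
  have s₂ := boxBoundary_upperHalf_subset hac hcb
  have t₁ : Q₀ ⊆ boxBoundary a (Function.update b i c) := fun x hx =>
    ⟨h01 hx, i, by simpa using hac, Or.inr (by simpa using (m₀.1 hx).2)⟩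
  have t₂ : Q₀ ⊆ boxBoundary (Function.update a i c) b := fun x hx =>
    ⟨h02 hx, i, by simpa using hcb, Or.inl (by simpa using (m₀.1 hx).2)⟩
  -- extension to the two halves
  obtain ⟨γ, hγ, g₁, hg₁, hg₁b, hg₁W⟩ := e₁ β G (hGc.mono s₁) fun x hx =>
    (hGW x (s₁ hx)).1 hx.1
  obtain ⟨δ, hδ, g₂, hg₂, hg₂b, hg₂W⟩ := e₂ γ (fun x => D.inclusion hγ (G x))
    ((D.inclusion hγ).continuous.comp_continuousOn (hGc.mono s₂)) fun x hx =>
    (hGW x (s₂ hx)).2 hx.1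
  let g' : (Fin k → ℝ) → D.Step δ := fun x => if x i ≤ c then D.inclusion hδ (g₁ x) else g₂ x
  have hg'₁ : EqOn g' (fun x => D.inclusion hδ (g₁ x)) Q₁ := fun x hx => if_pos (m₁.1 hx).2
  -- On the cutting face both extensions restrict to `G`, so the definition by cases is consistent.
  have hg'₂ : EqOn g' g₂ Q₂ := fun x hx => by
    rcases (m₂.1 hx).2.eq_or_lt with h | h
    · have hx₀ : x ∈ Q₀ := m₀.2 ⟨(m₂.1 hx).1, h.symm⟩
      exact ((if_pos h.ge).trans (congrArg _ (hg₁b x (t₁ hx₀)))).trans (hg₂b x (t₂ hx₀)).symm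
    · exact if_neg h.not_ge
  have hQ : Icc a b = Q₁ ∪ Q₂ := by
    ext x
    rw [mem_union, m₁, m₂, ← and_or_left]
    exact ⟨fun h => ⟨h, le_total _ _⟩, fun h => h.1⟩
  refine ⟨δ, (hβ.trans hγ).trans hδ, g', ?_, fun x hx => ?_, fun x hx => ?_⟩
  · rw [hQ]
    exact (((D.inclusion hδ).continuous.comp_continuousOn hg₁).congr hg'₁).union_of_isClosed
      (hg₂.congr hg'₂) isClosed_Icc isClosed_Icc
  · obtain ⟨hxQ, j, hj, hxj⟩ := hx
    have hx : x ∈ boxBoundary a b := ⟨hxQ, j, hj, hxj⟩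
    have e := hGg hx
    rw [hQ] at hxQ
    rcases hxQ with h | h
    · have hxb : x ∈ boxBoundary a (Function.update b i c) := by
        by_cases hji : j = i
        · subst hji
          rcases hxj with h' | h'
          · exact ⟨h, j, by simpa using hac, Or.inl h'⟩
          · exact absurd (m₁.1 h).2 (by rw [h']; exact hcb.not_ge)
        · exact ⟨h, j, by simpa [hji] using hj, by simpa [hji] using hxj⟩
      rw [hg'₁ h]
      change D.inclusion hδ (g₁ x) = _
      rw [hg₁b x hxb, e]
      rfl
    · have hxb : x ∈ boxBoundary (Function.update a i c) b := by
        by_cases hji : j = i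
        · subst hji
          rcases hxj with h' | h'
          · exact absurd (m₂.1 h).2 (by rw [h']; exact hac.not_ge)
          · exact ⟨h, j, by simpa using hcb, Or.inr h'⟩
        · exact ⟨h, j, by simpa [hji] using hj, by simpa [hji] using hxj⟩
      rw [hg'₂ h, hg₂b x hxb, e]
      rfl
  · rw [hQ] at hx
    rcases hx with h | h
    · rw [hg'₁ h]; exact hg₁W x h
    · rw [hg'₂ h]; exact hg₂W x h

/-- By a Lebesgue number argument, a small box is mapped by `f` into a single neighbourhood `O` from
the local extension property; closeness to `f` then just means taking values in `O`. -/
theorem LocallyExtends.exists_small (hD : D.LocallyExtends) (hf : Continuous f) (hW : IsOpen W)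
    {a₀ b₀ : Fin k → ℝ} (hfW : ∀ x ∈ Icc a₀ b₀, (x, f x) ∈ W) :
    ∃ δ > 0, ∀ a b, a₀ ≤ a → a ≤ b → b ≤ b₀ → (∀ i, b i - a i < δ) → D.ExtendsNear f W a b := by
  have key : ∀ x : Icc a₀ b₀, ∃ c : Set (Fin k → ℝ), IsOpen c ∧ x.1 ∈ c ∧
      ∀ a b, Icc a b ⊆ c → D.ExtendsNear f W a b := by
    rintro ⟨x, hx⟩
    obtain ⟨U, N, hU, hN, hxU, hxN, hUN⟩ := isOpen_prod_iff.1 hW x (f x) (hfW x hx)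
    obtain ⟨O, hO, hxO, hON, hext⟩ := hD (f x) N (hN.mem_nhds hxN)
    refine ⟨U ∩ f ⁻¹' O, hU.inter (hO.preimage hf), ⟨hxU, hxO⟩, fun a b hab => ?_⟩
    refine ⟨univ ×ˢ O, isOpen_univ.prod hO, fun y hy => ⟨mem_univ _, (hab hy).2⟩, ?_⟩
    intro α g hg hgO
    obtain ⟨β, h, g', hg', hg'b, hg'O⟩ := hext k a b α g hg fun y hy => (hgO y hy).2
    exact ⟨β, h, g', hg', hg'b, fun y hy => hUN ⟨(hab hy).1, hON (hg'O y hy)⟩⟩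
  choose c hc hxc hcext using key
  obtain ⟨δ, hδ, h⟩ := lebesgue_number_lemma_of_metric (isCompact_Icc (a := a₀) (b := b₀)) hc
    fun x hx => mem_iUnion.2 ⟨⟨x, hx⟩, hxc _⟩
  refine ⟨δ, hδ, fun a b ha hab hb hsmall => ?_⟩
  obtain ⟨x, hx⟩ := h a ⟨ha, hab.trans hb⟩
  refine hcext x a b fun y hy => hx ?_
  rw [Metric.mem_ball, dist_pi_lt_iff hδ]
  intro i
  rw [Real.dist_eq, abs_of_nonneg (sub_nonneg.2 (hy.1 i))]
  exact (sub_le_sub_right (hy.2 i) _).trans_lt (hsmall i)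

/-- If `M = ⋃ α, M_α` has the local extension property, then maps from the boundary of a box to some
`M_α` close to a continuous map from the box to `M` extend to maps from the box to some `M_β`. -/
theorem LocallyExtends.extendsNear (hD : D.LocallyExtends) (hf : Continuous f) (hW : IsOpen W)
    (hab : a ≤ b) (hfW : ∀ x ∈ Icc a b, (x, f x) ∈ W) : D.ExtendsNear f W a b := by
  classical
  -- Induction on the number of nondegenerate coordinates: cutting faces have fewer, and `W` must
  -- vary because the face has to meet the conditions of both halves.
  suffices H : ∀ (d : ℕ) (W : Set ((Fin k → ℝ) × M)) (a b : Fin k → ℝ), IsOpen W → a ≤ b →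
      (∀ x ∈ Icc a b, (x, f x) ∈ W) → (Finset.univ.filter fun i => a i < b i).card < d →
      D.ExtendsNear f W a b from H _ W a b hW hab hfW (Nat.lt_succ_self _)
  intro d
  induction d with
  | zero => exact fun _ _ _ _ _ _ h => absurd h (Nat.not_lt_zero _)
  | succ d ih =>
    intro W a₀ b₀ hW hab hfW hcard
    obtain ⟨δ, hδ, hsmall⟩ := hD.exists_small hf hW hfW
    refine box_bisection_induction (a₀ := a₀) (b₀ := b₀) hδ hsmall ?_ a₀ b₀ le_rfl hab le_rfl
    intro a b i ha hab hb hi h₁ h₂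
    have hac : a i < (a i + b i) / 2 := by linarith
    have hcb : (a i + b i) / 2 < b i := by linarith
    refine h₁.of_halves hac hcb h₂ fun V hV hfV => ih V _ _ hV ?_ hfV ?_
    · intro j
      by_cases hj : j = i
      · subst hj; simp
      · simpa [hj] using hab j
    · refine lt_of_lt_of_le (Finset.card_lt_card (t := Finset.univ.filter fun i => a₀ i < b₀ i) ?_)
        (Nat.lt_succ_iff.1 hcard)
      rw [Finset.ssubset_iff_of_subset]
      · exact ⟨i, by simpa using ((ha i).trans_lt hi).trans_le (hb i), by simp⟩
      · intro j hj
        have hji : j ≠ i := fun e => by subst e; simp at hj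
        simp only [Finset.mem_filter, Finset.mem_univ, true_and, ne_eq, hji, not_false_eq_true,
          Function.update_of_ne] at hj ⊢
        exact ((ha j).trans_lt hj).trans_le (hb j)

end DirectedUnion

/-! ### Cubes as boxes -/

section Cube

open scoped unitInterval

variable {k : ℕ}

/-- The retraction of `ℝ^k` onto the unit cube. -/
noncomputable def cubeProj (x : Fin k → ℝ) : I^ Fin k := fun i => projIcc 0 1 zero_le_one (x i)

/-- The inclusion of the unit cube into `ℝ^k`. -/
def cubeIncl (t : I^ Fin k) : Fin k → ℝ := fun i => t i

theorem continuous_cubeProj : Continuous (cubeProj (k := k)) :=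
  continuous_pi fun i => continuous_projIcc.comp (continuous_apply i)

theorem continuous_cubeIncl : Continuous (cubeIncl (k := k)) :=
  continuous_pi fun i => continuous_subtype_val.comp (continuous_apply i)

theorem cubeIncl_mem (t : I^ Fin k) : cubeIncl t ∈ Icc (0 : Fin k → ℝ) 1 :=
  ⟨fun i => (t i).2.1, fun i => (t i).2.2⟩

theorem cubeProj_cubeIncl (t : I^ Fin k) : cubeProj (cubeIncl t) = t :=
  funext fun i => projIcc_val zero_le_one (t i)

theorem cubeIncl_cubeProj {x : Fin k → ℝ} (hx : x ∈ Icc (0 : Fin k → ℝ) 1) :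
    cubeIncl (cubeProj x) = x := by
  ext i
  simp only [cubeIncl, cubeProj]
  rw [projIcc_of_mem zero_le_one ⟨hx.1 i, hx.2 i⟩]

theorem cubeIncl_mem_boxBoundary {t : I^ Fin k} :
    cubeIncl t ∈ boxBoundary (0 : Fin k → ℝ) 1 ↔ t ∈ Cube.boundary (Fin k) := by
  simp only [boxBoundary, mem_ofPred_eq, cubeIncl_mem, true_and, Cube.boundary, cubeIncl,
    Pi.zero_apply, Pi.one_apply, zero_lt_one]
  simp only [Icc.coe_eq_zero, Icc.coe_eq_one]

theorem cubeProj_mem_boundary {x : Fin k → ℝ} (hx : x ∈ boxBoundary (0 : Fin k → ℝ) 1) :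
    cubeProj x ∈ Cube.boundary (Fin k) := by
  rwa [← cubeIncl_mem_boxBoundary, cubeIncl_cubeProj hx.1]

/-- The projection of a cube that forgets the first coordinate. -/
def cubeTail (z : I^ Fin (k + 1)) : I^ Fin k := Fin.tail z

/-- The boundary of the cube of dimension `k + 1` as the union of bottom, top and sides. -/
theorem mem_boundary_succ_iff {t : I^ Fin (k + 1)} : t ∈ Cube.boundary (Fin (k + 1)) ↔
    (t 0 = 0 ∨ t 0 = 1) ∨ cubeTail t ∈ Cube.boundary (Fin k) :=
  Fin.exists_fin_succ

theorem cubeTail_cons (s : I) (t : I^ Fin k) : cubeTail (Fin.cons s t) = t := rfl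

theorem continuous_cubeTail : Continuous (cubeTail (k := k)) :=
  continuous_pi fun i => continuous_apply i.succ

theorem isClosed_cubeBoundary : IsClosed (Cube.boundary (Fin k)) := by
  have h := (isClosed_boxBoundary (0 : Fin k → ℝ) 1).preimage continuous_cubeIncl
  convert! h using 1
  ext t
  exact cubeIncl_mem_boxBoundary.symm

/-- Two loops, on the bottom and the top, and the constant map on the sides define a continuous map
on the boundary of the cylinder over a cube. -/
theorem exists_continuousOn_cylinder_boundary {Y : Type*} [TopologicalSpace Y] {y : Y}
    (γ₀ γ₁ : Ω^ (Fin k) Y y) :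
    ∃ G : (I^ Fin (k + 1)) → Y, ContinuousOn G (Cube.boundary (Fin (k + 1))) ∧
      (∀ t, G (Fin.cons 0 t) = γ₀ t) ∧ (∀ t, G (Fin.cons 1 t) = γ₁ t) ∧
      ∀ s, ∀ t ∈ Cube.boundary (Fin k), G (Fin.cons s t) = y := by
  classical
  let G : (I^ Fin (k + 1)) → Y := fun z =>
    if z 0 = 0 then γ₀ (cubeTail z) else if z 0 = 1 then γ₁ (cubeTail z) else y
  have h₀ : ∀ z, z 0 = 0 → G z = γ₀ (cubeTail z) := fun z hz => if_pos hz
  have h₁ : ∀ z, z 0 = 1 → G z = γ₁ (cubeTail z) := fun z hz => by simp [G, hz]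
  have h₂ : ∀ z, cubeTail z ∈ Cube.boundary (Fin k) → G z = y := fun z hz => by
    simp only [G]
    rw [GenLoop.boundary γ₀ _ hz, GenLoop.boundary γ₁ _ hz]
    simp
  have c₀ : ContinuousOn G {z | z 0 = 0} :=
    (γ₀.1.continuous.comp continuous_cubeTail).continuousOn.congr fun z hz => h₀ z hz
  have c₁ : ContinuousOn G {z | z 0 = 1} :=
    (γ₁.1.continuous.comp continuous_cubeTail).continuousOn.congr fun z hz => h₁ z hz
  have c₂ : ContinuousOn G {z | cubeTail z ∈ Cube.boundary (Fin k)} :=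
    continuousOn_const.congr fun z hz => h₂ z hz
  have hc₀ : IsClosed {z : I^ Fin (k + 1) | z 0 = 0} :=
    isClosed_eq (continuous_apply 0) continuous_const
  have hc₁ : IsClosed {z : I^ Fin (k + 1) | z 0 = 1} :=
    isClosed_eq (continuous_apply 0) continuous_const
  refine ⟨G, ?_, fun t => ?_, fun t => ?_, fun s t ht => ?_⟩
  · refine ((c₀.union_of_isClosed c₁ hc₀ hc₁).union_of_isClosed c₂ (hc₀.union hc₁)
      (isClosed_cubeBoundary.preimage continuous_cubeTail)).mono fun z hz => ?_
    exact mem_boundary_succ_iff.1 hz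
  · exact h₀ (Fin.cons 0 t) rfl
  · exact h₁ (Fin.cons 1 t) rfl
  · exact h₂ (Fin.cons s t) ht

end Cube

/-! ### Loops and homotopies -/

namespace DirectedUnion

open scoped unitInterval
open HomotopyGroup

variable {A : Type v} [Preorder A] {M : Type u} [TopologicalSpace M] {D : DirectedUnion A M}
  {k : ℕ}

/-- Loops in `M_α` which, together with the constant map on the sides, are close to a given map
`F` from the cylinder over the cube to `M`, become homotopic in some `M_β`. -/
theorem LocallyExtends.homotopic_of_near (hD : D.LocallyExtends) (F : C(I^ Fin (k + 1), M)) :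
    ∃ W : Set ((Fin (k + 1) → ℝ) × M), IsOpen W ∧ (∀ z, (cubeIncl z, F z) ∈ W) ∧
      ∀ (α : A) (p : D.Step α) (γ₀ γ₁ : Ω^ (Fin k) (D.Step α) p),
        (∀ t, (cubeIncl (Fin.cons 0 t), D.incl α (γ₀ t)) ∈ W) →
        (∀ t, (cubeIncl (Fin.cons 1 t), D.incl α (γ₁ t)) ∈ W) →
        (∀ s, ∀ t ∈ Cube.boundary (Fin k), (cubeIncl (Fin.cons s t), D.incl α p) ∈ W) →
        ∃ (β : A) (h : α ≤ β), GenLoop.Homotopic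
          (mapLoop (D.inclusion h) (rfl : _ = D.inclusion h p) γ₀)
          (mapLoop (D.inclusion h) (rfl : _ = D.inclusion h p) γ₁) := by
  -- Only the boundary values of the extension matter for a homotopy, so its graph is left
  -- unconstrained.
  obtain ⟨W, hW, hFW, hext⟩ := hD.extendsNear (F.continuous.comp continuous_cubeProj) isOpen_univ
    (a := (0 : Fin (k + 1) → ℝ)) (b := 1) zero_le_one fun x _ => mem_univ _
  refine ⟨W, hW, fun z => ?_, fun α p γ₀ γ₁ h₀ h₁ h₂ => ?_⟩
  · simpa [cubeProj_cubeIncl] using hFW _ (cubeIncl_mem z)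
  obtain ⟨G, hG, hG₀, hG₁, hG₂⟩ := exists_continuousOn_cylinder_boundary γ₀ γ₁
  obtain ⟨β, h, g, hg, hgb, -⟩ := hext α (fun x => G (cubeProj x))
    (hG.comp continuous_cubeProj.continuousOn fun x hx => cubeProj_mem_boundary hx) (by
      intro x hx
      obtain ⟨z, rfl⟩ : ∃ z, cubeIncl z = x := ⟨_, cubeIncl_cubeProj hx.1⟩
      rw [cubeIncl_mem_boxBoundary] at hx
      rw [cubeProj_cubeIncl]
      obtain ⟨s, t, rfl⟩ : ∃ s t, z = Fin.cons s t := ⟨z 0, cubeTail z, (Fin.cons_self_tail z).symm⟩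
      rcases mem_boundary_succ_iff.1 hx with (hs | hs) | ht
      · rw [Fin.cons_zero] at hs; subst hs; rw [hG₀]; exact h₀ t
      · rw [Fin.cons_zero] at hs; subst hs; rw [hG₁]; exact h₁ t
      · rw [cubeTail_cons] at ht; rw [hG₂ s t ht]; exact h₂ s t ht)
  have hcons : Continuous fun st : I × (I^ Fin k) => (Fin.cons st.1 st.2 : I^ Fin (k + 1)) :=
    Continuous.finCons (A := fun _ => I) continuous_fst continuous_snd
  have hgb' : ∀ z ∈ Cube.boundary (Fin (k + 1)), g (cubeIncl z) = D.inclusion h (G z) :=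
    fun z hz => by
      rw [hgb _ (cubeIncl_mem_boxBoundary.2 hz), cubeProj_cubeIncl]
  refine ⟨β, h, ⟨⟨⟨⟨fun st => g (cubeIncl (Fin.cons st.1 st.2)), ?_⟩, fun t => ?_, fun t => ?_⟩,
    fun s t ht => ?_⟩⟩⟩
  · exact hg.comp_continuous (continuous_cubeIncl.comp hcons) fun _ => cubeIncl_mem _
  · change g _ = D.inclusion h (γ₀ t)
    rw [hgb' _ (mem_boundary_succ_iff.2 (Or.inl (Or.inl rfl))), hG₀]
  · change g _ = D.inclusion h (γ₁ t)
    rw [hgb' _ (mem_boundary_succ_iff.2 (Or.inl (Or.inr rfl))), hG₁]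
  · change g _ = D.inclusion h (γ₀ t)
    rw [hgb' _ (mem_boundary_succ_iff.2 (Or.inr ?_)), hG₂ s t ht,
      GenLoop.boundary γ₀ t ht]
    exact ht

/-- Loops in `M_α` that are homotopic in `M` are homotopic in some `M_β`. -/
theorem LocallyExtends.exists_homotopic (hD : D.LocallyExtends) {α : A} {p : M} {q : D.Step α}
    (hq : D.incl α q = p) {γ₀ γ₁ : Ω^ (Fin k) (D.Step α) q}
    (H : GenLoop.Homotopic (mapLoop (D.incl α) hq γ₀) (mapLoop (D.incl α) hq γ₁)) :
    ∃ (β : A) (h : α ≤ β), GenLoop.Homotopic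
      (mapLoop (D.inclusion h) (rfl : _ = D.inclusion h q) γ₀)
      (mapLoop (D.inclusion h) (rfl : _ = D.inclusion h q) γ₁) := by
  obtain ⟨H⟩ := H
  let F : C(I^ Fin (k + 1), M) :=
    ⟨fun z => H (z 0, cubeTail z),
      H.continuous.comp ((continuous_apply 0).prodMk continuous_cubeTail)⟩
  have hF : ∀ s t, F (Fin.cons s t) = H (s, t) := fun s t => rfl
  -- The boundary data agree exactly with the homotopy `F`, so closeness is automatic.
  obtain ⟨W, -, hFW, h⟩ := hD.homotopic_of_near F
  refine h α q γ₀ γ₁ (fun t => ?_) (fun t => ?_) fun s t ht => ?_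
  · have := hFW (Fin.cons 0 t)
    rwa [hF, H.apply_zero] at this
  · have := hFW (Fin.cons 1 t)
    rwa [hF, H.apply_one] at this
  · have h1 := hFW (Fin.cons s t)
    have h2 : D.incl α (γ₀ t) = D.incl α q := congrArg _ (γ₀.2 t ht)
    rw [hF, H.eq_fst s ht] at h1
    rw [← h2]
    exact h1

/-- The trivial presentation of `M` as a union. -/
def trivialUnion (M : Type u) [TopologicalSpace M] : DirectedUnion PUnit.{1} M where
  carrier _ := univ
  topology _ := inferInstance
  mono _ _ _ := subset_rfl
  iUnion_eq := iUnion_const _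
  continuous_incl _ := continuous_subtype_val
  continuous_inclusion _ _ _ := continuous_id

/-- The only step of the trivial presentation of `M` is homeomorphic to `M`. -/
def trivialUnionHomeomorph (M : Type u) [TopologicalSpace M] (i : PUnit.{1}) :
    (trivialUnion M).Step i ≃ₜ M :=
  Homeomorph.Set.univ M

/-- Every chart of `M` is a weak direct limit chart of the union with one step, all linear maps
being identities. This makes `homotopic_of_near` available for homotopies in `M` itself. -/
theorem _root_.IsTVSManifold.locallyExtends_trivialUnion (hM : IsTVSManifold.{u, w} M) :
    (trivialUnion M).LocallyExtends := by
  refine AdmitsWeakDirectLimitCharts.locallyExtends.{u, 0, w} fun q => ?_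
  obtain ⟨E, φ, hq⟩ := hM.2 q
  refine ⟨E, φ, hq, PUnit.unit, fun _ => E,
    fun i => (trivialUnionHomeomorph M i).transOpenPartialHomeomorph φ,
    fun _ => ContinuousLinearMap.id ℝ E, fun _ _ _ => ContinuousLinearMap.id ℝ E,
    fun i x hx => ⟨hx, rfl⟩, fun i j h x hx => ⟨hx, rfl⟩, ?_⟩
  ext x
  simp only [mem_iUnion, mem_image]
  constructor
  · exact fun hx => ⟨⟨PUnit.unit, mem_Ici.2 le_rfl⟩, (⟨x, trivial⟩ : (univ : Set M)), hx, rfl⟩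
  · rintro ⟨i, y, hy, rfl⟩
    exact hy

/-- Each loop in `M` is homotopic to a loop in some `M_α`. -/
theorem LocallyExtends.exists_loop (hD : D.LocallyExtends)
    (hM : (trivialUnion M).LocallyExtends) {p : M} (γ : Ω^ (Fin k) M p) :
    ∃ (α : D.IndexAt p) (γ' : Ω^ (Fin k) (D.Step α.1) (D.pt α)),
      GenLoop.Homotopic (mapLoop (D.incl α.1) (D.incl_pt α) γ') γ := by
  -- The constant homotopy at `γ`: loops close to `γ` are homotopic to it in `M`.
  let F : C(I^ Fin (k + 1), M) := ⟨fun z => γ (cubeTail z), γ.1.continuous.comp continuous_cubeTail⟩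
  have hF : ∀ s t, F (Fin.cons s t) = γ t := fun s t => rfl
  obtain ⟨W, hW, hFW, hhom⟩ := hM.homotopic_of_near F
  have hc : Continuous fun x : (Fin k → ℝ) × M => ((Fin.cons 0 x.1 : Fin (k + 1) → ℝ), x.2) :=
    (Continuous.finCons (A := fun _ => ℝ) continuous_const continuous_fst).prodMk continuous_snd
  have hcons : ∀ t : I^ Fin k,
      (Fin.cons 0 (cubeIncl t) : Fin (k + 1) → ℝ) = cubeIncl (Fin.cons 0 t) := fun t => by
    ext i
    refine Fin.cases ?_ (fun i => ?_) i <;> simp [cubeIncl]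
  obtain ⟨V, -, hγV, hext⟩ := hD.extendsNear (γ.1.continuous.comp continuous_cubeProj)
    (hW.preimage hc) (a := (0 : Fin k → ℝ)) (b := 1) zero_le_one fun x hx => by
      obtain ⟨t, rfl⟩ : ∃ t, cubeIncl t = x := ⟨_, cubeIncl_cubeProj hx⟩
      have := hFW (Fin.cons 0 t)
      rw [hF] at this
      simpa [cubeProj_cubeIncl, hcons] using this
  obtain ⟨α⟩ : Nonempty (D.IndexAt p) := inferInstance
  -- The closeness required of `g` is that of the bottom face of the cylinder, namely the pullback
  -- of `W`.
  obtain ⟨β, h, g, hg, hgb, hgW⟩ := hext α.1 (fun _ => D.pt α) continuousOn_const fun x hx => by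
    have := hγV x hx.1
    rw [Function.comp_apply, γ.2 _ (cubeProj_mem_boundary hx)] at this
    exact this
  let β' : D.IndexAt p := ⟨β, D.mono h α.2⟩
  let γ' : Ω^ (Fin k) (D.Step β) (D.pt β') :=
    ⟨⟨fun t => g (cubeIncl t), hg.comp_continuous continuous_cubeIncl cubeIncl_mem⟩, fun t ht =>
      hgb _ (cubeIncl_mem_boxBoundary.2 ht)⟩
  let e := trivialUnionHomeomorph M PUnit.unit
  let ι : C(M, (trivialUnion M).Step PUnit.unit) := ⟨e.symm, e.symm.continuous⟩
  obtain ⟨j, hj, H⟩ := hhom PUnit.unit (ι p)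
    (mapLoop ι rfl (mapLoop (D.incl β) (D.incl_pt β') γ')) (mapLoop ι rfl γ)
    (fun t => by
      have := hgW _ (cubeIncl_mem t)
      rw [mem_preimage] at this
      simp only [hcons] at this
      exact this)
    (fun t => by
      have := hFW (Fin.cons 1 t)
      rw [hF] at this
      exact this)
    (fun s t ht => by
      have := hFW (Fin.cons s t)
      rw [hF, GenLoop.boundary γ t ht] at this
      exact this)
  exact ⟨β', γ', H.comp_continuousMap ((trivialUnion M).incl j)⟩

theorem piIncl_piBond (k : ℕ) (p : M) {α β : D.IndexAt p} (h : α ≤ β) (a : D.PiStep k p α) :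
    D.piIncl k p β (D.piBond k p α β h a) = D.piIncl k p α a :=
  HomotopyGroup.map_map (D.inclusion h) (D.incl β.1) rfl rfl rfl a

theorem LocallyExtends.exists_piBond_eq (hD : D.LocallyExtends) (p : M) (α : D.IndexAt p)
    (a b : D.PiStep k p α) (hab : D.piIncl k p α a = D.piIncl k p α b) :
    ∃ (β : D.IndexAt p) (h : α ≤ β), D.piBond k p α β h a = D.piBond k p α β h b := by
  induction a using Quotient.inductionOn with
  | h γ₀ =>
    induction b using Quotient.inductionOn with
    | h γ₁ =>
      obtain ⟨β, h, H⟩ := hD.exists_homotopic (D.incl_pt α) (Quotient.exact hab)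
      exact ⟨⟨β, D.mono h α.2⟩, h, Quotient.sound H⟩

theorem LocallyExtends.exists_piIncl_eq (hD : D.LocallyExtends)
    (hM : (trivialUnion M).LocallyExtends) (p : M) (a : π_ k M p) :
    ∃ (α : D.IndexAt p) (b : D.PiStep k p α), D.piIncl k p α b = a := by
  induction a using Quotient.inductionOn with
  | h γ =>
    obtain ⟨α, γ', H⟩ := hD.exists_loop hM γ
    exact ⟨α, Quotient.mk _ γ', Quotient.sound H⟩

end DirectedUnion

/-! ### Direct limits -/

section DirectLimit

variable {ι : Type*} [Preorder ι] [IsDirectedOrder ι] {F : ι → Type*}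
  {T : ∀ ⦃i j : ι⦄, i ≤ j → Type*} {f : ∀ i j (h : i ≤ j), T h}
  [∀ ⦃i j⦄ (h : i ≤ j), FunLike (T h) (F i) (F j)] [DirectedSystem F (f · · ·)] {C : Type*}

/-- The bijection from a direct limit induced by a compatible family of maps which is jointly
surjective, and injective up to bonding maps. -/
theorem DirectLimit.exists_equiv (g : ∀ i, F i → C)
    (compat : ∀ i j (h : i ≤ j) (x : F i), g j (f i j h x) = g i x)
    (inj : ∀ i (x y : F i), g i x = g i y → ∃ (j : ι) (h : i ≤ j), f i j h x = f i j h y)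
    (surj : ∀ c, ∃ i x, g i x = c) :
    ∃ e : DirectLimit F f ≃ C, ∀ i (x : F i), e ⟦⟨i, x⟩⟧ = g i x := by
  refine ⟨Equiv.ofBijective
    (DirectLimit.lift f g fun i j h x => (compat i j h x).symm) ⟨fun x y => ?_, fun c => ?_⟩,
    fun i x => rfl⟩
  · obtain ⟨i, x, y, rfl, rfl⟩ := DirectLimit.exists_eq_mk₂ f x y
    intro h
    obtain ⟨j, hj, e⟩ := inj i x y h
    exact Quotient.sound ⟨j, hj, hj, e⟩
  · obtain ⟨i, x, rfl⟩ := surj c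
    exact ⟨⟦⟨i, x⟩⟧, rfl⟩

/-- Two elements of the limit have representatives at a common index, where their product is
computed. -/
theorem DirectLimit.exists_mulEquiv [∀ i, Mul (F i)] [Mul C]
    [∀ i j h, MulHomClass (T (i := i) (j := j) h) (F i) (F j)] [Nonempty ι] (g : ∀ i, F i → C)
    (hg : ∀ i (x y : F i), g i (x * y) = g i x * g i y)
    (compat : ∀ i j (h : i ≤ j) (x : F i), g j (f i j h x) = g i x)
    (inj : ∀ i (x y : F i), g i x = g i y → ∃ (j : ι) (h : i ≤ j), f i j h x = f i j h y)
    (surj : ∀ c, ∃ i x, g i x = c) :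
    ∃ e : DirectLimit F f ≃* C, ∀ i (x : F i), e ⟦⟨i, x⟩⟧ = g i x := by
  obtain ⟨e, he⟩ := DirectLimit.exists_equiv g compat inj surj
  refine ⟨⟨e, fun x y => ?_⟩, he⟩
  obtain ⟨i, x, y, rfl, rfl⟩ := DirectLimit.exists_eq_mk₂ f x y
  change e _ = e _ * e _
  rw [DirectLimit.mul_def, he, he, he, hg]

end DirectLimit

theorem mainTheorem3 {A : Type v} [Preorder A] [IsDirectedOrder A]
    {M : Type u} [TopologicalSpace M] (D : DirectedUnion A M)
    (hM : IsTVSManifold.{u, w} M) (hD : ∀ α, IsTVSManifold.{u, w} (D.Step α))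
    (hchart : AdmitsWeakDirectLimitCharts.{u, v, w} D) :
    -- `π_k(M, p)` is the direct limit of the `π_k(M_α, p)` as a set, for all `k` and `p`
    (∀ (k : ℕ) (p : M),
      ∃ e : DirectLimit (D.PiStep k p) (D.piBond k p) ≃ π_ k M p,
        ∀ (α : D.IndexAt p) (a : D.PiStep k p α), e ⟦⟨α, a⟩⟧ = D.piIncl k p α a) ∧
    -- and as a group if `k ≥ 1`
    (∀ (k : ℕ) (p : M),
      ∃ e : DirectLimit (D.PiStep (k + 1) p) (D.piBondHom k p) ≃* π_ (k + 1) M p,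
        ∀ (α : D.IndexAt p) (a : D.PiStep (k + 1) p α),
          e ⟦⟨α, a⟩⟧ = D.piIncl (k + 1) p α a) ∧
    -- and as a group if `k = 0`, in the case of topological groups and `p = 1`
    (∀ [Group M] [IsTopologicalGroup M] [∀ α, Group (D.Step α)] [D.IsGroupUnion],
      ∃ e : DirectLimit (D.PiStep 0 (1 : M)) D.piZeroBondHom ≃* π_ 0 M (1 : M),
        ∀ (α : D.IndexAt (1 : M)) (a : D.PiStep 0 (1 : M) α),
          e ⟦⟨α, a⟩⟧ = D.piIncl 0 1 α a) := by
  have hL := hchart.locallyExtends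
  have hT := hM.locallyExtends_trivialUnion
  refine ⟨fun k p => ?_, fun k p => ?_, ?_⟩
  · exact DirectLimit.exists_equiv (D.piIncl k p) (fun _ _ h => D.piIncl_piBond k p h)
      (hL.exists_piBond_eq p) (hL.exists_piIncl_eq hT p)
  · exact DirectLimit.exists_mulEquiv (D.piIncl (k + 1) p)
      (fun α => HomotopyGroup.map_mul (D.incl α.1) (D.incl_pt α))
      (fun _ _ h => D.piIncl_piBond (k + 1) p h)
      (hL.exists_piBond_eq p) (hL.exists_piIncl_eq hT p)
  · intro _ _ _ _
    exact DirectLimit.exists_mulEquiv (D.piIncl 0 1)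
      (fun α => HomotopyGroup.map_mul_zero (D.incl α.1)
        (DirectedUnion.IsGroupUnion.incl_mul α.1) (D.incl_pt α))
      (fun _ _ h => D.piIncl_piBond 0 1 h)
      (hL.exists_piBond_eq 1) (hL.exists_piIncl_eq hT 1)
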